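/- Let $u_0\in(0,1)$ and let $f:[0,1]\to\mathbb R$ be a $C^1$ function of type B, i.e. $f(u)=0$ for all $u\in[0,u_0]$, $f(u)>0$ for all $u\in(u_0,1)$, and $f(1)=0$. Let $h:[0,1]\to\mathbb R$ be a $C^1$ function with $h(0)=0$, $h'(u)>0$ for every $u\in(0,1)$, and $h(u_0)<1+h(0)$. A number $c\in\mathbb R$ is called an admissible speed if there is a function $y:[0,1]\to\mathbb R$, differentiable on $[0,1]$ (one-sidedly at the end points), such that $$ (\star)\qquad y'(u)=\bigl(c+h'(u)\bigr)\frac{\sqrt{y(u)(2-y(u))}}{1-y(u)}-f(u)\quad (u\in[0,1]),\qquad y(0)=y(1)=0,\qquad 0<y(u)<1\ \text{ for } u\in(0,1). $$ Put $F^+=\int_{u_0}^1 f(u)\,du$ and fix $\eta$ with $0<\eta<\min\{F^+,1\}$. Then a positive admissible speed $c>0$ exists in each of the following two cases. 1) $F^+<1$ and $$ h(u_0)-h(0)<\sqrt{1-(1+\eta-F^+)^2},\qquad h(1)-h(u_0)<\frac{1-F^+}{\sqrt{F^+(2-F^+)}}\,\eta . $$ 2) $F^+\ge 1$ and, for some constants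 $\kappa\in(0,\eta)$ and $\xi_0\in(u_0,1)$ with $\int_{\xi_0}^1 f(u)\,du=1-\kappa$, $$ h(u_0)-h(0)<\sqrt{1-\eta^2},\qquad h(\xi_0)-h(u_0)<\sqrt{1-\Bigl(\frac{\kappa+\eta}{2}\Bigr)^2}-\sqrt{1-\eta^2},\qquad h(1)-h(\xi_0)<\frac{\eta-\kappa}{2}\,\frac{\kappa}{\sqrt{1-\kappa^2}} . $$ -/

import Mathlib

open Set

/-- Hypothesis on the reaction term: `f` is continuously differentiable on `[0, 1]`, vanishes at
`0`, at `u₀ ∈ [0, 1)` and at `1`, and is positive on `(u₀, 1)`. -/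
structure IsReactionTerm (f : ℝ → ℝ) (u₀ : ℝ) : Prop where
  contDiffOn : ContDiffOn ℝ 1 f (Icc 0 1)
  map_zero : f 0 = 0
  map_one : f 1 = 0
  mem : u₀ ∈ Ico (0 : ℝ) 1
  map_point : f u₀ = 0
  pos : ∀ u ∈ Ioo u₀ 1, 0 < f u

/-- Reaction terms of type B: `u₀ > 0` and `f` vanishes identically on `[0, u₀]`. -/
structure IsTypeB (f : ℝ → ℝ) (u₀ : ℝ) : Prop extends IsReactionTerm f u₀ where
  point_pos : 0 < u₀
  eq_zero : ∀ u ∈ Icc 0 u₀, f u = 0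

/-- Hypothesis on the convective term: `h` is continuously differentiable on `[0, 1]`,
`h 0 = 0`, and the derivative of `h` is positive on `(0, 1)`. -/
structure IsConvectiveTerm (h : ℝ → ℝ) : Prop where
  contDiffOn : ContDiffOn ℝ 1 h (Icc 0 1)
  map_zero : h 0 = 0
  deriv_pos : ∀ u ∈ Ioo (0 : ℝ) 1, 0 < derivWithin h (Icc 0 1) u

/-- `R(y) = √(y (2 - y)) / (1 - y)`, the inverse of `Q(s) = 1 - 1 / √(1 + s ^ 2)` on `[0, 1)`. -/
noncomputable def curvatureR (y : ℝ) : ℝ := Real.sqrt (y * (2 - y)) / (1 - y)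

/-- `y` solves the first-order two-point problem with unit diffusion density:
`y' = (c + h'(u)) R(y) - f(u)` on `[0, 1]`, `y(0) = 0 = y(1)`, `0 < y < 1` on `(0, 1)`.
Derivatives at the end points are one-sided. -/
structure IsStarSolution (f h : ℝ → ℝ) (c : ℝ) (y : ℝ → ℝ) : Prop where
  hasDeriv : ∀ u ∈ Icc (0 : ℝ) 1,
    HasDerivWithinAt y ((c + derivWithin h (Icc 0 1) u) * curvatureR (y u) - f u) (Icc 0 1) u
  left : y 0 = 0
  right : y 1 = 0
  bounds : ∀ u ∈ Ioo (0 : ℝ) 1, 0 < y u ∧ y u < 1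

/-- `c` is an admissible speed if the two-point problem with parameter `c` is solvable. -/
def IsAdmissibleSpeed (f h : ℝ → ℝ) (c : ℝ) : Prop :=
  ∃ y : ℝ → ℝ, IsStarSolution f h c y

/-! Put S = √(y (2 - y)). On [0, u₀], where f = 0, the equation reads S' = c + h', so S = c u + h(u)
as long as this is below 1. On [u₀, 1] the equation is solved backward from y(1) = 0: R is
increasing, so backward solutions cannot drift apart, although R is not Lipschitz at 0. A speed is
admissible once the two values of S agree at u₀. The backward value stays below 1, while the
explicit one reaches 1 at c = (1 - h(u₀)) / u₀; by the intermediate value theorem it suffices to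
find a smaller c > 0 at which the backward value is the larger one
(`exists_isAdmissibleSpeed_of_lt`).

For this, z is at most the mass m of f on [p, 1]; if m < 1, integrating the equation with R(z) ≤
R(m) bounds z(p) from below (`sqrt_le_of_curvatureR_mul_lt`). If F < 1, take p = u₀. If F ≥ 1, take
p = ξ₀, where m = 1 - κ, and carry the bound down to u₀ by S' ≤ c + h'
(`IsBackwardSolution.sqrt_sub_le`). Strictness of the conditions on h leaves room for a small c > 0.
-/

/-! ### Backward comparison and solvability -/

/-- One-sided comparison, going backwards from the right end point of the interval. -/
theorem le_mul_sub_of_neg_le_deriv {D D' : ℝ → ℝ} {p q K : ℝ}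
    (hD : ∀ u ∈ Icc p q, HasDerivWithinAt D (D' u) (Icc p q) u) (hq : D q ≤ 0) (hK : 0 ≤ K)
    (h : ∀ u ∈ Ioo p q, 0 < D u → -K ≤ D' u) : ∀ u ∈ Icc p q, D u ≤ K * (q - u) := by
  intro u hu
  by_contra! hlt
  have hcont : ContinuousOn (fun x => D x - K * (q - x)) (Icc u q) := by
    have : ContinuousOn D (Icc u q) := fun x hx =>
      ((hD x ⟨hu.1.trans hx.1, hx.2⟩).continuousWithinAt).mono (Icc_subset_Icc_left hu.1)
    fun_prop
  have hcpt : IsCompact {x ∈ Icc u q | D x - K * (q - x) ≤ 0} :=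
    isCompact_Icc.of_isClosed_subset
      (hcont.preimage_isClosed_of_isClosed isClosed_Icc isClosed_Iic) (sep_subset _ _)
  -- Up to the first v where the bound holds, D is positive, so D - K (q - ·) is nondecreasing and
  -- stays positive at v: a contradiction.
  obtain ⟨v, hv, hmin⟩ := hcpt.exists_isLeast ⟨q, ⟨hu.2, le_rfl⟩, by simpa using hq⟩
  have hpos : ∀ x ∈ Ioo u v, 0 < D x - K * (q - x) := by
    intro x hx
    by_contra! hx0
    exact absurd (hmin ⟨⟨hx.1.le, hx.2.le.trans hv.1.2⟩, hx0⟩) (not_le.2 hx.2)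
  have hmono : MonotoneOn (fun x => D x - K * (q - x)) (Icc u v) := by
    refine monotoneOn_of_hasDerivWithinAt_nonneg (f' := fun x => D' x + K) (convex_Icc u v)
      (hcont.mono (Icc_subset_Icc_right hv.1.2)) ?_ ?_
    · intro x hx
      rw [interior_Icc] at hx ⊢
      have h1 := (hD x ⟨hu.1.trans hx.1.le, hx.2.le.trans hv.1.2⟩).mono
        (Ioo_subset_Icc_self.trans (Icc_subset_Icc hu.1 hv.1.2) : Ioo u v ⊆ Icc p q)
      have h2 : HasDerivWithinAt (fun x => K * (q - x)) (-K) (Ioo u v) x := by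
        simpa using (((hasDerivAt_id x).const_sub q).const_mul K).hasDerivWithinAt
      exact (h1.sub h2).congr_deriv (sub_neg_eq_add _ _)
    · intro x hx
      rw [interior_Icc] at hx
      have h0 : x < q := hx.2.trans_le hv.1.2
      have := h x ⟨hu.1.trans_lt hx.1, h0⟩
        (by nlinarith [hpos x hx, mul_nonneg hK (sub_nonneg.2 h0.le)])
      linarith
  have := hmono (left_mem_Icc.2 hv.1.1) (right_mem_Icc.2 hv.1.1) hv.1.1
  simp only at this
  linarith [hv.2]

theorem exists_backward_of_lipschitzWith {a b G : ℝ → ℝ} {p q B : ℝ} {K : NNReal} (hpq : p ≤ q)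
    (ha : ContinuousOn a (Icc p q)) (hb : ContinuousOn b (Icc p q))
    (hG : LipschitzWith K G) (hB : ∀ y, |G y| ≤ B) :
    ∃ z : ℝ → ℝ, z q = 0 ∧
      ∀ u ∈ Icc p q, HasDerivWithinAt z (a u * G (z u) - b u) (Icc p q) u := by
  obtain ⟨A, hA⟩ := isCompact_Icc.exists_bound_of_continuousOn ha
  obtain ⟨C, hC⟩ := isCompact_Icc.exists_bound_of_continuousOn hb
  have hA0 : 0 ≤ A := (norm_nonneg _).trans (hA p ⟨le_rfl, hpq⟩)
  have hC0 : 0 ≤ C := (norm_nonneg _).trans (hC p ⟨le_rfl, hpq⟩)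
  have hB0 : 0 ≤ B := (abs_nonneg _).trans (hB 0)
  lift A to NNReal using hA0
  lift B to NNReal using hB0
  lift C to NNReal using hC0
  -- The right-hand side is bounded by A B + C for every y, so a ball of radius (A B + C)(q - p) is
  -- never left and the solution lives on all of [p, q].
  have hPL : IsPicardLindelof (fun u y => a u * G y - b u)
      (⟨q, hpq, le_rfl⟩ : Icc p q) 0 ((A * B + C) * Real.toNNReal (q - p)) 0 (A * B + C)
      (A * K) := by
    constructor
    · intro t ht
      refine LipschitzOnWith.of_dist_le_mul fun x _ y _ => ?_
      have h1 := hG.dist_le_mul x y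
      have h2 := hA t ht
      rw [Real.dist_eq] at h1 ⊢
      rw [show a t * G x - b t - (a t * G y - b t) = a t * (G x - G y) by ring, abs_mul]
      push_cast
      rw [mul_assoc]
      exact mul_le_mul h2 h1 (abs_nonneg _) A.2
    · intro x _
      fun_prop
    · intro t ht x _
      push_cast
      refine (norm_sub_le _ _).trans (add_le_add ?_ (hC t ht))
      rw [norm_mul]
      exact mul_le_mul (hA t ht) (hB x) (abs_nonneg _) A.2
    · simp [hpq]
  exact hPL.exists_eq_forall_mem_Icc_hasDerivWithinAt₀

open Filter Topology MeasureTheory in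
/-- Backward solvability of `z' = a(u) g(z) - b(u)`, `z(q) = 0`, for a bounded monotone `g`
which is a uniform limit of monotone Lipschitz functions. -/
theorem exists_backward_of_monotone {a b g : ℝ → ℝ} {G : ℕ → ℝ → ℝ} {ε : ℕ → ℝ} {p q B : ℝ}
    (hpq : p ≤ q) (ha : ContinuousOn a (Icc p q)) (hb : ContinuousOn b (Icc p q))
    (ha0 : ∀ u ∈ Ioo p q, 0 ≤ a u)
    (hgc : Continuous g) (hgm : Monotone g) (hGB : ∀ n y, |G n y| ≤ B)
    (hGL : ∀ n, ∃ K, LipschitzWith K (G n)) (hGg : ∀ n y, |G n y - g y| ≤ ε n)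
    (hε : Tendsto ε atTop (𝓝 0)) :
    ∃ z : ℝ → ℝ, z q = 0 ∧
      ∀ u ∈ Icc p q, HasDerivWithinAt z (a u * g (z u) - b u) (Icc p q) u := by
  obtain ⟨A, hA⟩ := isCompact_Icc.exists_bound_of_continuousOn ha
  obtain ⟨C, hC⟩ := isCompact_Icc.exists_bound_of_continuousOn hb
  have hA0 : 0 ≤ A := (norm_nonneg _).trans (hA p ⟨le_rfl, hpq⟩)
  have hz : ∀ n, ∃ z : ℝ → ℝ, z q = 0 ∧
      ∀ u ∈ Icc p q, HasDerivWithinAt z (a u * G n (z u) - b u) (Icc p q) u := fun n => by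
    obtain ⟨K, hK⟩ := hGL n
    exact exists_backward_of_lipschitzWith hpq ha hb hK (hGB n)
  choose z hzq hz using hz
  have hε0 : ∀ n, 0 ≤ ε n := fun n => (abs_nonneg _).trans (hGg n 0)
  -- Where z n > z m, monotonicity of g leaves only the approximation errors; hence (z n) is
  -- pointwise Cauchy, whatever the Lipschitz constants.
  have hone : ∀ n m, ∀ u ∈ Icc p q, z n u - z m u ≤ A * (ε n + ε m) * (q - u) := by
    intro n m
    refine le_mul_sub_of_neg_le_deriv (fun u hu => (hz n u hu).sub (hz m u hu))
      (by simp [hzq]) (mul_nonneg hA0 (add_nonneg (hε0 n) (hε0 m))) ?_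
    intro u hu hpos
    have hu' := Ioo_subset_Icc_self hu
    have h1 : g (z m u) ≤ g (z n u) := hgm (by simp at hpos; linarith)
    have h2 := abs_le.1 (hGg n (z n u))
    have h3 := abs_le.1 (hGg m (z m u))
    have h4 : -(ε n + ε m) ≤ G n (z n u) - G m (z m u) := by linarith
    have h5 : a u ≤ A := (le_abs_self _).trans (hA u hu')
    have h6 := mul_le_mul_of_nonneg_left h4 (ha0 u hu)
    have h7 := mul_le_mul_of_nonneg_right h5 (add_nonneg (hε0 n) (hε0 m))
    linarith
  have hcau : ∀ u ∈ Icc p q, ∃ l, Tendsto (fun n => z n u) atTop (𝓝 l) := by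
    intro u hu
    refine cauchySeq_tendsto_of_complete (Metric.cauchySeq_iff.2 fun δ hδ => ?_)
    have ht : Tendsto (fun n => A * (ε n) * (q - u)) atTop (𝓝 0) := by
      simpa using (hε.const_mul A).mul_const (q - u)
    obtain ⟨N, hN⟩ := eventually_atTop.1 (ht.eventually (gt_mem_nhds (half_pos hδ)))
    refine ⟨N, fun m hm n hn => ?_⟩
    rw [Real.dist_eq, abs_lt]
    constructor <;> linarith [hone m n u hu, hone n m u hu, hN m hm, hN n hn]
  let w : ℝ → ℝ := fun u => if hu : u ∈ Icc p q then (hcau u hu).choose else 0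
  have hw : ∀ u ∈ Icc p q, Tendsto (fun n => z n u) atTop (𝓝 (w u)) := by
    intro u hu
    simp only [w, dif_pos hu]
    exact (hcau u hu).choose_spec
  have hbound : ∀ n, ∀ u ∈ Icc p q, ∀ y, |a u * G n y - b u| ≤ A * B + C := by
    intro n u hu y
    refine (abs_sub _ _).trans (add_le_add ?_ (hC u hu))
    rw [abs_mul]
    exact mul_le_mul (hA u hu) (hGB n y) (abs_nonneg _) hA0
  have hwlip : ∀ x ∈ Icc p q, ∀ y ∈ Icc p q, |w y - w x| ≤ (A * B + C) * |y - x| := by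
    intro x hx y hy
    refine le_of_tendsto ((hw y hy).sub (hw x hx)).abs (Eventually.of_forall fun n => ?_)
    exact (convex_Icc p q).norm_image_sub_le_of_norm_hasDerivWithin_le (hz n)
      (fun u hu => hbound n u hu _) hx hy
  have hwc : ContinuousOn w (Icc p q) := by
    refine LipschitzOnWith.continuousOn (K := Real.toNNReal (A * B + C))
      (LipschitzOnWith.of_dist_le_mul fun x hx y hy => ?_)
    rw [Real.dist_eq, Real.dist_eq]
    exact (hwlip y hy x hx).trans
      (mul_le_mul_of_nonneg_right (Real.le_coe_toNNReal _) (abs_nonneg _))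
  have hvc : ContinuousOn (fun u => a u * g (w u) - b u) (Icc p q) :=
    (ha.mul (hgc.comp_continuousOn hwc)).sub hb
  have hzc : ∀ n, ContinuousOn (fun u => a u * G n (z n u) - b u) (Icc p q) := fun n => by
    obtain ⟨K, hK⟩ := hGL n
    exact (ha.mul (hK.continuous.comp_continuousOn
      fun u hu => (hz n u hu).continuousWithinAt)).sub hb
  -- The limit is taken in the integral equation, by dominated convergence.
  have hint : ∀ u ∈ Icc p q, ∫ x in p..u, (a x * g (w x) - b x) = w u - w p := by
    intro u hu
    have hsub : Icc p u ⊆ Icc p q := Icc_subset_Icc_right hu.2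
    have h1 : ∀ n, ∫ x in p..u, (a x * G n (z n x) - b x) = z n u - z n p := by
      intro n
      refine intervalIntegral.integral_eq_sub_of_hasDerivAt_of_le hu.1
        (fun x hx => ((hz n x (hsub hx)).mono hsub).continuousWithinAt)
        (fun x hx => (hz n x (hsub (Ioo_subset_Icc_self hx))).hasDerivAt
          (Icc_mem_nhds hx.1 (hx.2.trans_le hu.2)))
        (((hzc n).mono hsub).intervalIntegrable_of_Icc hu.1)
    have h2 : Tendsto (fun n => ∫ x in p..u, (a x * G n (z n x) - b x)) atTop
        (𝓝 (∫ x in p..u, (a x * g (w x) - b x))) := by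
      refine intervalIntegral.tendsto_integral_filter_of_dominated_convergence
        (fun _ => A * B + C) (Eventually.of_forall fun n => ?_)
        (Eventually.of_forall fun n => Eventually.of_forall fun x hx => ?_)
        intervalIntegrable_const (Eventually.of_forall fun x hx => ?_)
      · rw [uIoc_of_le hu.1]
        exact (((hzc n).mono hsub).mono Ioc_subset_Icc_self).aestronglyMeasurable
          measurableSet_Ioc
      · rw [uIoc_of_le hu.1] at hx
        exact hbound n x (hsub (Ioc_subset_Icc_self hx)) _
      · rw [uIoc_of_le hu.1] at hx
        have hx' := hsub (Ioc_subset_Icc_self hx)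
        have h3 : Tendsto (fun n => G n (z n x)) atTop (𝓝 (g (w x))) := by
          have h4 : Tendsto (fun n => G n (z n x) - g (z n x)) atTop (𝓝 0) :=
            squeeze_zero_norm (fun n => hGg n _) hε
          simpa using h4.add ((hgc.tendsto _).comp (hw x hx'))
        exact (h3.const_mul _).sub_const _
    simp_rw [h1] at h2
    exact tendsto_nhds_unique h2 ((hw u hu).sub (hw p ⟨le_rfl, hpq⟩))
  have hq : q ∈ Icc p q := ⟨hpq, le_rfl⟩
  refine ⟨w, tendsto_nhds_unique (hw q hq) (by simp [hzq]), fun u hu => ?_⟩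
  have := Fact.mk hu
  have hd : HasDerivWithinAt (fun y => ∫ x in p..y, (a x * g (w x) - b x))
      (a u * g (w u) - b u) (Icc p q) u :=
    intervalIntegral.integral_hasDerivWithinAt_right
      ((hvc.mono (Icc_subset_Icc_right hu.2)).intervalIntegrable_of_Icc hu.1)
      (hvc.stronglyMeasurableAtFilter_nhdsWithin measurableSet_Icc u) (hvc u hu)
  refine (hd.add_const (w p)).congr (fun y hy => ?_) ?_
  · rw [hint y hy]; ring
  · rw [hint u hu]; ring

/-! ### The function R and its truncation -/

theorem curvatureR_zero : curvatureR 0 = 0 := by simp [curvatureR]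

theorem curvatureR_nonneg {y : ℝ} (hy : y < 1) : 0 ≤ curvatureR y :=
  div_nonneg (Real.sqrt_nonneg _) (by linarith)

theorem curvatureR_monotoneOn : MonotoneOn curvatureR (Ico 0 1) := by
  intro x hx y hy hxy
  exact div_le_div₀ (Real.sqrt_nonneg _) (Real.sqrt_le_sqrt (by nlinarith [hx.1, hy.2]))
    (by linarith [hy.2]) (by linarith)

theorem curvatureR_continuousOn : ContinuousOn curvatureR (Iio 1) := by
  refine ContinuousOn.div (by fun_prop) (by fun_prop) fun x hx => ?_
  have : x < 1 := hx
  linarith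

theorem curvatureR_contDiffOn : ContDiffOn ℝ 1 curvatureR (Ioo 0 1) := by
  refine ContDiffOn.div (ContDiffOn.sqrt (by fun_prop) fun x hx => ?_) (by fun_prop) fun x hx => ?_
  · exact (mul_pos hx.1 (by linarith [hx.2])).ne'
  · linarith [hx.2]

/-- The value of `R` on the lower part of the unit circle `S ↦ 1 - √(1 - S ^ 2)`. -/
theorem curvatureR_one_sub_sqrt {S : ℝ} (hS : 0 ≤ S) (hS1 : S ≤ 1) :
    curvatureR (1 - Real.sqrt (1 - S ^ 2)) = S / Real.sqrt (1 - S ^ 2) := by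
  have h := Real.sq_sqrt (show 0 ≤ 1 - S ^ 2 by nlinarith)
  rw [curvatureR, show (1 - Real.sqrt (1 - S ^ 2)) * (2 - (1 - Real.sqrt (1 - S ^ 2))) = S ^ 2 by
    nlinarith, Real.sqrt_sq hS, sub_sub_cancel]

theorem exists_curvatureR_eq {s : ℝ} (hs : 0 < s) : ∃ M ∈ Ioo (0 : ℝ) 1, curvatureR M = s := by
  have h1 : 0 < 1 + s ^ 2 := by positivity
  have hsq : 1 < Real.sqrt (1 + s ^ 2) := by
    rw [Real.lt_sqrt] <;> nlinarith
  have h2 := Real.sq_sqrt h1.le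
  set r := Real.sqrt (1 + s ^ 2)
  have hr : 0 < r := by linarith
  refine ⟨1 - 1 / r, ⟨?_, ?_⟩, ?_⟩
  · rw [sub_pos, div_lt_one hr]; exact hsq
  · have : 0 < 1 / r := by positivity
    linarith
  · have : (1 - 1 / r) * (2 - (1 - 1 / r)) = (s / r) ^ 2 := by
      field_simp
      nlinarith
    rw [curvatureR, this, Real.sqrt_sq (by positivity), sub_sub_cancel]
    field_simp

open Filter Topology in
-- R has infinite slope at 0. Clipping its argument to [M / (n + 1), M] makes it Lipschitz, at the
-- cost of a uniform error R(M / (n + 1)) → 0.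
theorem exists_backward_curvatureR_projIcc {a b : ℝ → ℝ} {p q M : ℝ} (hpq : p ≤ q)
    (ha : ContinuousOn a (Icc p q)) (hb : ContinuousOn b (Icc p q))
    (ha0 : ∀ u ∈ Ioo p q, 0 ≤ a u) (hM : 0 < M) (hM1 : M < 1) :
    ∃ z : ℝ → ℝ, z q = 0 ∧ ∀ u ∈ Icc p q,
      HasDerivWithinAt z (a u * curvatureR (projIcc 0 M hM.le (z u)) - b u) (Icc p q) u := by
  have hsub : Icc 0 M ⊆ Ico 0 1 := fun x hx => ⟨hx.1, hx.2.trans_lt hM1⟩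
  have he : ∀ n : ℕ, 0 < M / (n + 1) := fun n => by positivity
  have heM : ∀ n : ℕ, M / (n + 1) ≤ M := fun n =>
    div_le_self hM.le (by linarith [(Nat.cast_nonneg n : (0 : ℝ) ≤ n)])
  have hmem : ∀ (n : ℕ) y, (projIcc _ M (heM n) y : ℝ) ∈ Icc 0 M := fun n y =>
    ⟨(he n).le.trans (projIcc _ M (heM n) y).2.1, (projIcc _ M (heM n) y).2.2⟩
  refine exists_backward_of_monotone (G := fun n y => curvatureR (projIcc _ M (heM n) y))
    (g := fun y => curvatureR (projIcc 0 M hM.le y)) (ε := fun n => curvatureR (M / (n + 1)))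
    (B := curvatureR M) hpq ha hb ha0 ?_ ?_ ?_ ?_ ?_ ?_
  · refine (curvatureR_continuousOn.mono fun x hx => (hsub hx).2).comp_continuous
      (continuous_subtype_val.comp continuous_projIcc) fun y => Subtype.coe_prop _
  · intro x y hxy
    exact curvatureR_monotoneOn (hsub (Subtype.coe_prop _)) (hsub (Subtype.coe_prop _))
      (monotone_projIcc hM.le hxy)
  · intro n y
    rw [abs_of_nonneg (curvatureR_nonneg (hsub (hmem n y)).2)]
    exact curvatureR_monotoneOn (hsub (hmem n y)) (hsub ⟨hM.le, le_rfl⟩) (hmem n y).2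
  · intro n
    obtain ⟨K, hK⟩ := (curvatureR_contDiffOn.mono
      (fun x hx => ⟨(he n).trans_le hx.1, hx.2.trans_lt hM1⟩ :
        Icc (M / (n + 1)) M ⊆ Ioo 0 1)).exists_lipschitzOnWith one_ne_zero
        (convex_Icc _ _) isCompact_Icc
    refine ⟨K, LipschitzWith.of_dist_le_mul fun x y => ?_⟩
    refine (hK.dist_le_mul _ (Subtype.coe_prop _) _ (Subtype.coe_prop _)).trans
      (mul_le_mul_of_nonneg_left ?_ K.2)
    simpa [Subtype.dist_eq] using (LipschitzWith.projIcc (heM n)).dist_le_mul x y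
  · intro n y
    have h0 := hsub (projIcc 0 M hM.le y).2
    have h1 := hsub (hmem n y)
    have hle : (projIcc 0 M hM.le y : ℝ) ≤ projIcc _ M (heM n) y := by
      rw [coe_projIcc, coe_projIcc]
      exact max_le_max_right _ (he n).le
    rw [abs_of_nonneg (sub_nonneg.2 (curvatureR_monotoneOn h0 h1 hle))]
    rcases le_total (M / (n + 1)) (min M y) with h | h
    · have : (projIcc 0 M hM.le y : ℝ) = projIcc _ M (heM n) y := by
        rw [coe_projIcc, coe_projIcc, max_eq_right h, max_eq_right ((he n).le.trans h)]
      rw [this, sub_self]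
      exact curvatureR_nonneg ((heM n).trans_lt hM1)
    · have : (projIcc _ M (heM n) y : ℝ) = M / (n + 1) := by
        rw [coe_projIcc, max_eq_left h]
      rw [this]
      linarith [curvatureR_nonneg h0.2]
  · have h1 : Tendsto (fun n : ℕ => M / ((n : ℝ) + 1)) atTop (𝓝 0) := by
      simpa [div_eq_mul_inv] using
        (tendsto_one_div_add_atTop_nhds_zero_nat (𝕜 := ℝ)).const_mul M
    have h2 : ContinuousAt curvatureR 0 :=
      curvatureR_continuousOn.continuousAt (Iio_mem_nhds one_pos)
    have := h2.tendsto.comp h1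
    rwa [curvatureR_zero] at this

/-! ### Backward solutions and their estimates -/

/-- `z` solves `z' = a(u) R(z) - b(u)` on `[p, q]` with `z(q) = 0` and values in `[0, 1)`. -/
structure IsBackwardSolution (a b : ℝ → ℝ) (p q : ℝ) (z : ℝ → ℝ) : Prop where
  terminal : z q = 0
  hasDeriv : ∀ u ∈ Icc p q, HasDerivWithinAt z (a u * curvatureR (z u) - b u) (Icc p q) u
  nonneg : ∀ u ∈ Icc p q, 0 ≤ z u
  lt_one : ∀ u ∈ Icc p q, z u < 1

/-- The constants 0 and M are barriers for the truncated equation, so the truncation is never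
active. -/
theorem exists_isBackwardSolution {a b : ℝ → ℝ} {p q M : ℝ} (hpq : p ≤ q)
    (ha : ContinuousOn a (Icc p q)) (hb : ContinuousOn b (Icc p q))
    (ha0 : ∀ u ∈ Ioo p q, 0 ≤ a u) (hb0 : ∀ u ∈ Ioo p q, 0 ≤ b u)
    (hM : 0 < M) (hM1 : M < 1) (hbM : ∀ u ∈ Ioo p q, b u ≤ a u * curvatureR M) :
    ∃ z, IsBackwardSolution a b p q z ∧ ∀ u ∈ Icc p q, z u ≤ M := by
  obtain ⟨z, hzq, hz⟩ := exists_backward_curvatureR_projIcc hpq ha hb ha0 hM hM1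
  have h0 : ∀ u ∈ Icc p q, 0 ≤ z u := by
    intro u hu
    have := le_mul_sub_of_neg_le_deriv (fun v hv => (hz v hv).neg) (by simp [hzq]) le_rfl
      (fun v hv hpos => by
        simp only [Pi.neg_apply] at hpos
        rw [projIcc_of_le_left _ (by linarith : z v ≤ 0)]
        simpa [curvatureR_zero] using hb0 v hv) u hu
    simpa using this
  have h1 : ∀ u ∈ Icc p q, z u ≤ M := by
    intro u hu
    have := le_mul_sub_of_neg_le_deriv (fun v hv => (hz v hv).sub_const M)
      (by simp [hzq, hM.le]) le_rfl
      (fun v hv hpos => by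
        rw [projIcc_of_right_le _ (by linarith : M ≤ z v)]
        simpa using hbM v hv) u hu
    simpa using this
  refine ⟨z, ⟨hzq, fun u hu => ?_, h0, fun u hu => (h1 u hu).trans_lt hM1⟩, h1⟩
  have := hz u hu
  rwa [projIcc_of_mem _ ⟨h0 u hu, h1 u hu⟩] at this

namespace IsBackwardSolution

variable {a a₁ a₂ b z z₁ z₂ H β : ℝ → ℝ} {p q M : ℝ}

theorem mem_Ico (hz : IsBackwardSolution a b p q z) {u : ℝ} (hu : u ∈ Icc p q) :
    z u ∈ Ico 0 1 := ⟨hz.nonneg u hu, hz.lt_one u hu⟩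

theorem mono {p' : ℝ} (hz : IsBackwardSolution a b p q z) (hp : p ≤ p') :
    IsBackwardSolution a b p' q z where
  terminal := hz.terminal
  hasDeriv u hu := (hz.hasDeriv u (Icc_subset_Icc_left hp hu)).mono (Icc_subset_Icc_left hp)
  nonneg u hu := hz.nonneg u (Icc_subset_Icc_left hp hu)
  lt_one u hu := hz.lt_one u (Icc_subset_Icc_left hp hu)

theorem continuousOn (hz : IsBackwardSolution a b p q z) : ContinuousOn z (Icc p q) :=
  fun u hu => (hz.hasDeriv u hu).continuousWithinAt

theorem hasDerivAt (hz : IsBackwardSolution a b p q z) {u : ℝ} (hu : u ∈ Ioo p q) :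
    HasDerivAt z (a u * curvatureR (z u) - b u) u :=
  (hz.hasDeriv u (Ioo_subset_Icc_self hu)).hasDerivAt (Icc_mem_nhds hu.1 hu.2)

/-- An interior zero would be a minimum, yet there z' = -b < 0. -/
theorem pos (hz : IsBackwardSolution a b p q z) (hb : ∀ u ∈ Ioo p q, 0 < b u) {u : ℝ}
    (hu : u ∈ Ioo p q) : 0 < z u := by
  refine (hz.nonneg u (Ioo_subset_Icc_self hu)).lt_of_ne fun h0 => ?_
  have hmin : IsLocalMin z u := by
    filter_upwards [Ioo_mem_nhds hu.1 hu.2] with v hv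
    rw [← h0]
    exact hz.nonneg v (Ioo_subset_Icc_self hv)
  have := hmin.hasDerivAt_eq_zero (hz.hasDerivAt hu)
  rw [← h0, curvatureR_zero] at this
  linarith [hb u hu]

/-- Lipschitz dependence of backward solutions on the coefficient `a`. -/
theorem sub_le {δ : ℝ} (h₁ : IsBackwardSolution a₁ b p q z₁)
    (h₂ : IsBackwardSolution a₂ b p q z₂) (ha : ∀ u ∈ Ioo p q, 0 ≤ a₁ u) (hδ : 0 ≤ δ)
    (hd : ∀ u ∈ Ioo p q, a₂ u - a₁ u ≤ δ) (hM : 0 ≤ M) (hM1 : M < 1)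
    (hzM : ∀ u ∈ Icc p q, z₂ u ≤ M) {u : ℝ} (hu : u ∈ Icc p q) :
    z₁ u - z₂ u ≤ δ * curvatureR M * (q - u) := by
  refine le_mul_sub_of_neg_le_deriv (fun v hv => (h₁.hasDeriv v hv).sub (h₂.hasDeriv v hv))
    (by simp [h₁.terminal, h₂.terminal]) (mul_nonneg hδ (curvatureR_nonneg hM1)) ?_ u hu
  intro v hv hpos
  have hv' := Ioo_subset_Icc_self hv
  simp only [Pi.sub_apply] at hpos
  -- Splits the difference of derivatives as a₁ (R(z₁) - R(z₂)) - (a₂ - a₁) R(z₂).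
  have h3 := mul_le_mul_of_nonneg_left (curvatureR_monotoneOn (h₂.mem_Ico hv') (h₁.mem_Ico hv')
    (by linarith)) (ha v hv)
  have h4 := mul_le_mul_of_nonneg_right (hd v hv) (curvatureR_nonneg (h₂.lt_one v hv'))
  have h5 := mul_le_mul_of_nonneg_left (curvatureR_monotoneOn (h₂.mem_Ico hv') ⟨hM, hM1⟩
    (hzM v hv')) hδ
  linarith

/-- z + β has derivative a R(z) ≥ 0. -/
theorem le_primitive (hz : IsBackwardSolution a b p q z) (ha : ∀ u ∈ Ioo p q, 0 ≤ a u)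
    (hβ : ∀ u ∈ Icc p q, HasDerivWithinAt β (b u) (Icc p q) u) {u : ℝ} (hu : u ∈ Icc p q) :
    z u ≤ β q - β u := by
  have := le_mul_sub_of_neg_le_deriv
    (fun v hv => ((hz.hasDeriv v hv).add (hβ v hv)).sub_const (β q))
    (by simp [hz.terminal]) le_rfl (fun v hv _ => by
      have := mul_nonneg (ha v hv) (curvatureR_nonneg (hz.lt_one v (Ioo_subset_Icc_self hv)))
      linarith) u hu
  simp only [Pi.add_apply, zero_mul] at this
  linarith

/-- z + β has derivative a R(z) ≤ R(M) H'. -/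
theorem primitive_sub_le (hz : IsBackwardSolution a b p q z) (hpq : p ≤ q)
    (ha : ∀ u ∈ Ioo p q, 0 ≤ a u)
    (hβ : ∀ u ∈ Icc p q, HasDerivWithinAt β (b u) (Icc p q) u)
    (hH : ∀ u ∈ Icc p q, HasDerivWithinAt H (a u) (Icc p q) u)
    (hM : 0 ≤ M) (hM1 : M < 1) (hzM : ∀ u ∈ Icc p q, z u ≤ M) :
    β q - β p - curvatureR M * (H q - H p) ≤ z p := by
  have := le_mul_sub_of_neg_le_deriv
    (fun v hv => (((hH v hv).const_mul (curvatureR M)).sub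
      ((hz.hasDeriv v hv).add (hβ v hv))).sub_const (curvatureR M * H q - β q))
    (by simp [hz.terminal]) le_rfl (fun v hv _ => ?_) p ⟨le_rfl, hpq⟩
  · simp only [Pi.sub_apply, Pi.add_apply, zero_mul] at this
    linarith
  · have hv' := Ioo_subset_Icc_self hv
    have := mul_le_mul_of_nonneg_left (curvatureR_monotoneOn (hz.mem_Ico hv') ⟨hM, hM1⟩
      (hzM v hv')) (ha v hv)
    linarith

/-- In terms of `S = √(z (2 - z))` the equation gives `S' ≤ a`. -/
theorem sqrt_sub_le (hz : IsBackwardSolution a b p q z) (hb : ∀ u ∈ Ioo p q, 0 < b u)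
    (hH : ∀ u ∈ Icc p q, HasDerivWithinAt H (a u) (Icc p q) u) {ξ : ℝ} (hξ : ξ ∈ Icc p q) :
    Real.sqrt (z ξ * (2 - z ξ)) - Real.sqrt (z p * (2 - z p)) ≤ H ξ - H p := by
  have hmono : MonotoneOn (fun u => H u - Real.sqrt (z u * (2 - z u))) (Icc p q) := by
    have hzc := hz.continuousOn
    have hHc : ContinuousOn H (Icc p q) := fun u hu => (hH u hu).continuousWithinAt
    refine monotoneOn_of_hasDerivWithinAt_nonneg
      (f' := fun u => b u * (1 - z u) / Real.sqrt (z u * (2 - z u))) (convex_Icc p q)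
      (by fun_prop) ?_ ?_
    · intro u hu
      rw [interior_Icc] at hu ⊢
      have hu' := Ioo_subset_Icc_self hu
      have h1 := hz.lt_one u hu'
      have hpos : 0 < z u * (2 - z u) := mul_pos (hz.pos hb hu) (by linarith)
      have hsq := Real.sqrt_pos.2 hpos
      have hd := hz.hasDerivAt hu
      refine HasDerivAt.hasDerivWithinAt ((((hH u hu').hasDerivAt (Icc_mem_nhds hu.1 hu.2)).sub
        ((hd.mul (hd.const_sub 2)).sqrt hpos.ne')).congr_deriv ?_)
      simp only [curvatureR, Pi.mul_apply]
      have h2 : 1 - z u ≠ 0 := by linarith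
      field_simp
      ring
    · intro u hu
      rw [interior_Icc] at hu
      have := hz.lt_one u (Ioo_subset_Icc_self hu)
      exact div_nonneg (mul_nonneg (hb u hu).le (by linarith)) (Real.sqrt_nonneg _)
  have := hmono ⟨le_rfl, hξ.1.trans hξ.2⟩ hξ hξ.1
  simp only at this
  linarith

end IsBackwardSolution

/-! ### The convective term and the explicit branch -/

namespace IsConvectiveTerm

variable {h : ℝ → ℝ}

theorem hasDerivWithinAt (hh : IsConvectiveTerm h) (c : ℝ) {p q : ℝ} (hp : 0 ≤ p) (hq : q ≤ 1) :
    ∀ u ∈ Icc p q, HasDerivWithinAt (fun u => c * u + h u) (c + derivWithin h (Icc 0 1) u)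
      (Icc p q) u := by
  intro u hu
  have h1 := ((hh.contDiffOn.differentiableOn one_ne_zero u
    (Icc_subset_Icc hp hq hu)).hasDerivWithinAt).mono (Icc_subset_Icc hp hq)
  exact (((hasDerivAt_id u).const_mul c).hasDerivWithinAt.add h1).congr_deriv (by rw [mul_one])

theorem continuousOn_derivWithin (hh : IsConvectiveTerm h) :
    ContinuousOn (derivWithin h (Icc 0 1)) (Icc 0 1) :=
  hh.contDiffOn.continuousOn_derivWithin (uniqueDiffOn_Icc zero_lt_one) le_rfl

theorem strictMonoOn (hh : IsConvectiveTerm h) : StrictMonoOn h (Icc 0 1) := by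
  refine strictMonoOn_of_deriv_pos (convex_Icc 0 1) hh.contDiffOn.continuousOn fun u hu => ?_
  rw [interior_Icc] at hu
  rw [← derivWithin_of_mem_nhds (Icc_mem_nhds hu.1 hu.2)]
  exact hh.deriv_pos u hu

/-- The explicit solution of `y' = (c + h'(u)) R(y)` with `y(0) = 0`. -/
theorem hasDerivWithinAt_circle (hh : IsConvectiveTerm h) {c u₀ : ℝ} (hc : 0 < c)
    (hu₀ : u₀ ≤ 1) (hlt : c * u₀ + h u₀ < 1) {u : ℝ} (hu : u ∈ Icc 0 u₀) :
    HasDerivWithinAt (fun u => 1 - Real.sqrt (1 - (c * u + h u) ^ 2))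
      ((c + derivWithin h (Icc 0 1) u) *
        curvatureR (1 - Real.sqrt (1 - (c * u + h u) ^ 2))) (Icc 0 u₀) u := by
  have hmono := hh.strictMonoOn.monotoneOn
  have hu1 : u ∈ Icc (0 : ℝ) 1 := ⟨hu.1, hu.2.trans hu₀⟩
  have h0 : 0 ≤ c * u + h u := by
    have := hmono ⟨le_rfl, zero_le_one⟩ hu1 hu.1
    rw [hh.map_zero] at this
    have := mul_nonneg hc.le hu.1
    linarith
  have h1 : c * u + h u < 1 := by
    have := hmono hu1 ⟨hu.1.trans hu.2, hu₀⟩ hu.2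
    nlinarith [mul_le_mul_of_nonneg_left hu.2 hc.le]
  have hpos : 0 < 1 - (c * u + h u) ^ 2 := by nlinarith
  rw [curvatureR_one_sub_sqrt h0 h1.le]
  refine (((((hh.hasDerivWithinAt c le_rfl hu₀ u hu).pow 2).const_sub 1).sqrt
    hpos.ne').const_sub 1).congr_deriv ?_
  have := Real.sqrt_pos.2 hpos
  simp only [Pi.pow_apply]
  field_simp
  norm_num
  ring

end IsConvectiveTerm

/-! ### Matching at u₀ and shooting in the speed -/

section Shooting

variable {f h : ℝ → ℝ} {u₀ c : ℝ}

/-- Equal S means equal y, since y ↦ y (2 - y) is injective on [0, 1]; the equation then makes the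
one-sided derivatives at u₀ agree. -/
theorem isAdmissibleSpeed_of_matching (hf : IsTypeB f u₀) (hh : IsConvectiveTerm h)
    (hc : 0 < c) (hlt : c * u₀ + h u₀ < 1) {z : ℝ → ℝ}
    (hz : IsBackwardSolution (fun u => c + derivWithin h (Icc 0 1) u) f u₀ 1 z)
    (hm : Real.sqrt (z u₀ * (2 - z u₀)) = c * u₀ + h u₀) : IsAdmissibleSpeed f h c := by
  have hu₀ := hf.point_pos
  have hu₁ : u₀ < 1 := hf.mem.2
  have hmono := hh.strictMonoOn
  have hz0 := hz.mem_Ico ⟨le_rfl, hu₁.le⟩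
  have hzu : z u₀ = 1 - Real.sqrt (1 - (c * u₀ + h u₀) ^ 2) := by
    rw [← hm, Real.sq_sqrt (mul_nonneg hz0.1 (by linarith [hz0.2])),
      show 1 - z u₀ * (2 - z u₀) = (1 - z u₀) ^ 2 by ring,
      Real.sqrt_sq (by linarith [hz0.2])]
    ring
  have hS : ∀ u ∈ Ioc 0 u₀, 0 < c * u + h u ∧ c * u + h u < 1 := by
    intro u hu
    have h1 := hmono ⟨le_rfl, zero_le_one⟩ ⟨hu.1.le, hu.2.trans hu₁.le⟩ hu.1
    have h2 := hmono.monotoneOn ⟨hu.1.le, hu.2.trans hu₁.le⟩ ⟨hu₀.le, hu₁.le⟩ hu.2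
    rw [hh.map_zero] at h1
    have := mul_pos hc hu.1
    constructor
    · linarith
    · linarith [mul_le_mul_of_nonneg_left hu.2 hc.le]
  let y : ℝ → ℝ := fun u => if u ≤ u₀ then 1 - Real.sqrt (1 - (c * u + h u) ^ 2) else z u
  have hyl : ∀ u ≤ u₀, y u = 1 - Real.sqrt (1 - (c * u + h u) ^ 2) := fun u hu => if_pos hu
  have hyr : ∀ u, u₀ ≤ u → y u = z u := by
    intro u hu
    rcases hu.eq_or_lt with rfl | hu
    · rw [hyl _ le_rfl, hzu]
    · exact if_neg (not_le.2 hu)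
  have hdl : ∀ u ∈ Icc 0 u₀, HasDerivWithinAt y
      ((c + derivWithin h (Icc 0 1) u) * curvatureR (y u) - f u) (Icc 0 u₀) u := by
    intro u hu
    rw [hf.eq_zero u hu, sub_zero, hyl u hu.2]
    exact (hh.hasDerivWithinAt_circle hc hu₁.le hlt hu).congr (fun v hv => hyl v hv.2)
      (hyl u hu.2)
  have hdr : ∀ u ∈ Icc u₀ 1, HasDerivWithinAt y
      ((c + derivWithin h (Icc 0 1) u) * curvatureR (y u) - f u) (Icc u₀ 1) u := by
    intro u hu
    rw [hyr u hu.1]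
    exact (hz.hasDeriv u hu).congr (fun v hv => hyr v hv.1) (hyr u hu.1)
  refine ⟨y, fun u hu => ?_, ?_, ?_, fun u hu => ?_⟩
  · suffices H : HasDerivWithinAt y ((c + derivWithin h (Icc 0 1) u) * curvatureR (y u) - f u)
        (Icc 0 u₀ ∪ Icc u₀ 1) u by rwa [Icc_union_Icc_eq_Icc hu₀.le hu₁.le] at H
    rcases lt_trichotomy u u₀ with hlt | rfl | hlt
    -- Away from the closure of the other interval, differentiability within it is vacuous.
    · refine (hdl u ⟨hu.1, hlt.le⟩).union (HasFDerivWithinAt.of_notMem_closure ?_)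
      rw [closure_Icc]
      exact fun hm => not_le.2 hlt hm.1
    · exact (hdl u ⟨hu.1, le_rfl⟩).union (hdr u ⟨le_rfl, hu.2⟩)
    · refine HasDerivWithinAt.union (HasFDerivWithinAt.of_notMem_closure ?_) (hdr u ⟨hlt.le, hu.2⟩)
      rw [closure_Icc]
      exact fun hm => not_le.2 hlt hm.2
  · rw [hyl 0 hu₀.le, hh.map_zero]
    simp
  · rw [hyr 1 hu₁.le, hz.terminal]
  · rcases le_or_gt u u₀ with hle | hgt
    · obtain ⟨h0, h1⟩ := hS u ⟨hu.1, hle⟩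
      rw [hyl u hle]
      have hp : 0 < 1 - (c * u + h u) ^ 2 := by nlinarith
      have hlt1 : Real.sqrt (1 - (c * u + h u) ^ 2) < 1 := by
        rw [Real.sqrt_lt' one_pos]
        nlinarith
      constructor <;> linarith [Real.sqrt_pos.2 hp]
    · rw [hyr u hgt.le]
      exact ⟨hz.pos hf.pos ⟨hgt, hu.2⟩, hz.lt_one u ⟨hgt.le, hu.2.le⟩⟩

/-- Shooting: a speed is admissible as soon as, for some small speed, the backward solution lies
above the explicit solution at `u₀`. -/
theorem exists_isAdmissibleSpeed_of_lt (hf : IsTypeB f u₀) (hh : IsConvectiveTerm h)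
    (hc : 0 < c) (hlt : c * u₀ + h u₀ < 1)
    (hc' : ∀ z, IsBackwardSolution (fun u => c + derivWithin h (Icc 0 1) u) f u₀ 1 z →
      c * u₀ + h u₀ < Real.sqrt (z u₀ * (2 - z u₀))) :
    ∃ c : ℝ, 0 < c ∧ IsAdmissibleSpeed f h c := by
  have hu₀ := hf.point_pos
  have hu₁ : u₀ < 1 := hf.mem.2
  have hsub : Icc u₀ 1 ⊆ Icc 0 1 := Icc_subset_Icc_left hu₀.le
  have hh0 : ∀ u ∈ Ioo u₀ 1, 0 < derivWithin h (Icc 0 1) u := fun u hu =>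
    hh.deriv_pos u ⟨hu₀.trans hu.1, hu.2⟩
  obtain ⟨B, hB⟩ := isCompact_Icc.exists_bound_of_continuousOn hf.contDiffOn.continuousOn
  have hB0 : 0 ≤ B := (norm_nonneg _).trans (hB 0 ⟨le_rfl, zero_le_one⟩)
  -- With R(M) = (B + 1) / c, the constant M is an upper barrier for all speeds d ≥ c at once, which
  -- makes the Lipschitz constant in d uniform.
  obtain ⟨M, hM, hMB⟩ := exists_curvatureR_eq (s := (B + 1) / c) (by positivity)
  have hex : ∀ d, ∃ z, c ≤ d →
      IsBackwardSolution (fun u => d + derivWithin h (Icc 0 1) u) f u₀ 1 z ∧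
        ∀ u ∈ Icc u₀ 1, z u ≤ M := by
    intro d
    by_cases hd : c ≤ d
    · obtain ⟨z, hz⟩ := exists_isBackwardSolution (a := fun u => d + derivWithin h (Icc 0 1) u)
        (b := f) (M := M) hu₁.le (continuousOn_const.add (hh.continuousOn_derivWithin.mono hsub))
        (hf.contDiffOn.continuousOn.mono hsub)
        (fun u hu => by linarith [hh0 u hu]) (fun u hu => (hf.pos u hu).le) hM.1 hM.2
        (fun u hu => by
          have h1 := (le_abs_self _).trans (hB u (hsub (Ioo_subset_Icc_self hu)))
          have h2 : c * ((B + 1) / c) = B + 1 := by field_simp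
          have h3 : 0 < (B + 1) / c := by positivity
          rw [hMB]
          nlinarith [hh0 u hu])
      exact ⟨z, fun _ => hz⟩
    · exact ⟨0, fun h => absurd h hd⟩
  choose z hz using hex
  have hlip : ∀ d e, c ≤ d → c ≤ e →
      z d u₀ - z e u₀ ≤ |d - e| * (curvatureR M * (1 - u₀)) := by
    intro d e hd he
    rw [← mul_assoc]
    refine (hz d hd).1.sub_le (hz e he).1 (fun u hu => by linarith [hh0 u hu]) (abs_nonneg _)
      (fun u hu => ?_) hM.1.le hM.2 (hz e he).2 ⟨le_rfl, hu₁.le⟩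
    rw [abs_sub_comm]
    linarith [le_abs_self (e - d)]
  -- The speed at which the explicit branch reaches S = 1 at u₀.
  set d := (1 - h u₀) / u₀ with hd
  have hdu : d * u₀ = 1 - h u₀ := by rw [hd]; field_simp
  have hcd : c ≤ d := by
    rw [hd, le_div_iff₀ hu₀]
    linarith
  have hcont : ContinuousOn (fun e => z e u₀) (Icc c d) := by
    refine LipschitzOnWith.continuousOn (K := Real.toNNReal (curvatureR M * (1 - u₀)))
      (LipschitzOnWith.of_dist_le_mul fun x hx y hy => ?_)
    rw [Real.dist_eq, Real.dist_eq, Real.coe_toNNReal _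
      (mul_nonneg (curvatureR_nonneg hM.2) (by linarith)), mul_comm, abs_le]
    have h1 := hlip x y hx.1 hy.1
    have h2 := hlip y x hy.1 hx.1
    rw [abs_sub_comm] at h2
    constructor <;> linarith
  have hlt1 : Real.sqrt (z d u₀ * (2 - z d u₀)) < 1 := by
    have := (hz d hcd).1.lt_one u₀ ⟨le_rfl, hu₁.le⟩
    rw [Real.sqrt_lt' one_pos]
    nlinarith
  have hivt := intermediate_value_Icc' hcd
    (f := fun e => Real.sqrt (z e u₀ * (2 - z e u₀)) - (e * u₀ + h u₀)) (by fun_prop)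
  obtain ⟨e, he, he0⟩ := hivt ⟨by rw [hdu]; linarith, (sub_pos.2 (hc' _ (hz c le_rfl).1)).le⟩
  have heq : Real.sqrt (z e u₀ * (2 - z e u₀)) = e * u₀ + h u₀ := sub_eq_zero.1 he0
  refine ⟨e, hc.trans_le he.1, isAdmissibleSpeed_of_matching hf hh (hc.trans_le he.1) ?_
    (hz e he.1).1 heq⟩
  rw [← heq]
  have := (hz e he.1).1.lt_one u₀ ⟨le_rfl, hu₁.le⟩
  rw [Real.sqrt_lt' one_pos]
  nlinarith

theorem IsTypeB.hasDerivWithinAt_integral (hf : IsTypeB f u₀) {p : ℝ} (hp : u₀ ≤ p) :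
    ∀ u ∈ Icc p 1, HasDerivWithinAt (fun v => ∫ x in p..v, f x) (f u) (Icc p 1) u := by
  intro u hu
  have := Fact.mk hu
  have hfc : ContinuousOn f (Icc p 1) :=
    hf.contDiffOn.continuousOn.mono (Icc_subset_Icc_left (hf.point_pos.le.trans hp))
  exact intervalIntegral.integral_hasDerivWithinAt_right
    ((hfc.mono (Icc_subset_Icc_right hu.2)).intervalIntegrable_of_Icc hu.1)
    (hfc.stronglyMeasurableAtFilter_nhdsWithin measurableSet_Icc u) (hfc u hu)

/-- Lower bound for the backward solution at `p` when the mass of `f` on `[p, 1]` is `m < 1`. -/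
theorem sqrt_le_of_curvatureR_mul_lt (hf : IsTypeB f u₀) (hh : IsConvectiveTerm h) (hc : 0 < c)
    {p m δ : ℝ} {z : ℝ → ℝ} (hp : p ∈ Ico u₀ 1) (hm : ∫ u in p..1, f u = m) (hm1 : m < 1)
    (hδ : curvatureR m * (c * (1 - p) + (h 1 - h p)) < δ)
    (hz : IsBackwardSolution (fun u => c + derivWithin h (Icc 0 1) u) f p 1 z) :
    Real.sqrt (1 - (1 + δ - m) ^ 2) ≤ Real.sqrt (z p * (2 - z p)) := by
  have ha : ∀ u ∈ Ioo p 1, 0 ≤ c + derivWithin h (Icc 0 1) u := fun u hu =>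
    (add_pos hc (hh.deriv_pos u ⟨(hf.point_pos.trans_le hp.1).trans hu.1, hu.2⟩)).le
  have hf0 : ∀ u ∈ Ioo p 1, 0 < f u := fun u hu => hf.pos u ⟨hp.1.trans_lt hu.1, hu.2⟩
  have hβ := hf.hasDerivWithinAt_integral hp.1
  have hH := hh.hasDerivWithinAt c (hf.point_pos.le.trans hp.1) le_rfl
  have hβmono : MonotoneOn (fun v => ∫ x in p..v, f x) (Icc p 1) := by
    refine monotoneOn_of_hasDerivWithinAt_nonneg (f' := f) (convex_Icc p 1)
      (fun u hu => (hβ u hu).continuousWithinAt) (fun u hu => ?_) (fun u hu => ?_)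
    · exact (hβ u (interior_subset hu)).mono interior_subset
    · rw [interior_Icc] at hu
      exact (hf0 u hu).le
  have hp' : p ∈ Icc p 1 := ⟨le_rfl, hp.2.le⟩
  have hβ0 : ∀ u ∈ Icc p 1, 0 ≤ ∫ x in p..u, f x := fun u hu => by
    simpa using hβmono hp' hu hu.1
  have hzm : ∀ u ∈ Icc p 1, z u ≤ m := fun u hu => by
    have := hz.le_primitive ha hβ hu
    rw [hm] at this
    linarith [hβ0 u hu]
  have hm0 : 0 ≤ m := (hz.nonneg p hp').trans (hzm p hp')
  have h1 := hz.primitive_sub_le hp.2.le ha hβ hH hm0 hm1 hzm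
  have h2 := hz.lt_one p hp'
  simp only [hm, intervalIntegral.integral_same] at h1
  have h3 : m - δ < z p := by
    have : c * 1 + h 1 - (c * p + h p) = c * (1 - p) + (h 1 - h p) := by ring
    rw [this] at h1
    linarith
  -- z (2 - z) = 1 - (1 - z)², and 0 < 1 - z < 1 + δ - m.
  refine Real.sqrt_le_sqrt ?_
  nlinarith

open Filter Topology in
-- Strict inequalities at c = 0 persist for small c > 0.
theorem exists_pos_mul_add_lt {a a' b b' l l' : ℝ} (h : b < l) (h' : b' < l') :
    ∃ c > 0, c * a + b < l ∧ c * a' + b' < l' := by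
  have key : ∀ {a b l : ℝ}, b < l → ∀ᶠ c in 𝓝[>] (0 : ℝ), c * a + b < l := by
    intro a b l h
    have ht : Tendsto (fun c : ℝ => c * a + b) (𝓝 0) (𝓝 (0 * a + b)) :=
      Continuous.tendsto (by fun_prop) 0
    exact (ht.mono_left nhdsWithin_le_nhds).eventually (gt_mem_nhds (by simpa using h))
  obtain ⟨c, ⟨h1, h2⟩, hc⟩ := (((key h).and (key h')).and self_mem_nhdsWithin).exists
  exact ⟨c, hc, h1, h2⟩

theorem curvatureR_mul_lt_of_lt {m t δ : ℝ} (hm : 0 < m) (hm1 : m < 1)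
    (h : t < δ / curvatureR m) : curvatureR m * t < δ := by
  have : 0 < curvatureR m :=
    div_pos (Real.sqrt_pos.2 (mul_pos hm (by linarith))) (by linarith)
  rwa [lt_div_iff₀' this] at h

theorem sqrt_one_sub_sq_le_one (x : ℝ) : Real.sqrt (1 - x ^ 2) ≤ 1 :=
  Real.sqrt_le_one.2 (by nlinarith [sq_nonneg x])

end Shooting

/-! ### The two cases -/

theorem mainTheorem4 (f h : ℝ → ℝ) (u₀ : ℝ) (hf : IsTypeB f u₀) (hh : IsConvectiveTerm h)
    (hstim : h u₀ < 1 + h 0) (F η : ℝ) (hF : F = ∫ u in u₀..1, f u)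
    (hη_pos : 0 < η) (hη : η < min F 1) :
    (F < 1 →
      h u₀ - h 0 < Real.sqrt (1 - (1 + η - F) ^ 2) →
      h 1 - h u₀ < (1 - F) / Real.sqrt (F * (2 - F)) * η →
      ∃ c : ℝ, 0 < c ∧ IsAdmissibleSpeed f h c) ∧
    (1 ≤ F → ∀ κ ξ₀ : ℝ, 0 < κ → κ < η → ξ₀ ∈ Set.Ioo u₀ 1 →
      ∫ u in ξ₀..1, f u = 1 - κ →
      h u₀ - h 0 < Real.sqrt (1 - η ^ 2) →
      h ξ₀ - h u₀ < Real.sqrt (1 - ((κ + η) / 2) ^ 2) - Real.sqrt (1 - η ^ 2) →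
      h 1 - h ξ₀ < (η - κ) / 2 * (κ / Real.sqrt (1 - κ ^ 2)) →
      ∃ c : ℝ, 0 < c ∧ IsAdmissibleSpeed f h c) := by
  have hu₀ := hf.point_pos
  have hu₁ : u₀ < 1 := hf.mem.2
  have hηF : η < F := hη.trans_le (min_le_left _ _)
  have hη1 : η < 1 := hη.trans_le (min_le_right _ _)
  rw [hh.map_zero]
  simp only [sub_zero]
  constructor
  · intro hF1 h1 h2
    have h2' : h 1 - h u₀ < η / curvatureR F := by
      rw [curvatureR, div_div_eq_mul_div]
      exact h2.trans_eq (by ring)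
    obtain ⟨c, hc, hc1, hc2⟩ := exists_pos_mul_add_lt (a := u₀) (a' := 1 - u₀) h1 h2'
    refine exists_isAdmissibleSpeed_of_lt hf hh hc
      (hc1.trans_le (sqrt_one_sub_sq_le_one _)) fun z hz => ?_
    exact hc1.trans_le (sqrt_le_of_curvatureR_mul_lt hf hh hc ⟨le_rfl, hu₁⟩ hF.symm hF1
      (curvatureR_mul_lt_of_lt (hη_pos.trans hηF) hF1 hc2) hz)
  · intro _ κ ξ hκ hκη hξ hint h1 h2 h3
    -- Adding the first two conditions cancels √(1 - η²).
    have h1' : h ξ < Real.sqrt (1 - ((κ + η) / 2) ^ 2) := by linarith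
    have h3' : h 1 - h ξ < (η - κ) / 2 / curvatureR (1 - κ) := by
      rw [curvatureR, show (1 - κ) * (2 - (1 - κ)) = 1 - κ ^ 2 by ring, sub_sub_cancel,
        div_div_eq_mul_div]
      exact h3.trans_eq (by ring)
    obtain ⟨c, hc, hc1, hc2⟩ := exists_pos_mul_add_lt (a := ξ) (a' := 1 - ξ) h1' h3'
    have hlt : h u₀ < h ξ :=
      hh.strictMonoOn ⟨hu₀.le, hu₁.le⟩ ⟨hu₀.le.trans hξ.1.le, hξ.2.le⟩ hξ.1
    refine exists_isAdmissibleSpeed_of_lt hf hh hc ?_ fun z hz => ?_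
    · have := hc1.trans_le (sqrt_one_sub_sq_le_one _)
      linarith [mul_lt_mul_of_pos_left hξ.1 hc]
    -- Here m = 1 - κ and δ = (η - κ) / 2, so that 1 + δ - m = (κ + η) / 2.
    · have h4 := sqrt_le_of_curvatureR_mul_lt hf hh hc ⟨hξ.1.le, hξ.2⟩ hint (by linarith)
        (curvatureR_mul_lt_of_lt (by linarith) (by linarith) hc2) (hz.mono hξ.1.le)
      have h5 := hz.sqrt_sub_le hf.pos (hh.hasDerivWithinAt c hu₀.le le_rfl)
        ⟨hξ.1.le, hξ.2.le⟩
      rw [show 1 + (η - κ) / 2 - (1 - κ) = (κ + η) / 2 by ring] at h4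
      linarith
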